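/- Let $n\ge 7$ be odd, put $D=(n-1)/2$, and let $\Gamma=\tfrac12H(n,2)$ be the halved cube: its vertices are the binary words of length $n$ of even weight, two being adjacent when they are at Hamming distance $2$. Let $X$ be the vertex set of $\Gamma$ and let $\partial$ be its distance function. The diameter of $\Gamma$ is $D$. Fix $x\in X$, let $A$ be the adjacency matrix of $\Gamma$, let $V=\mathbb C^X$, for $0\le i\le D$ let $E^*_i$ be the diagonal matrix with $(y,y)$-entry $1$ if $\partial(x,y)=i$ and $0$ otherwise, and put $L=\sum_{i=1}^{D}E^*_{i-1}AE^*_i$ and $R=\sum_{i=0}^{D-1}E^*_{i+1}AE^*_i$. Then $$e_i^-RL^2+LRL+e_i^+L^2R=f_iL$$ is satisfied on $E^*_iV$ for $1\le i\le D$, where $e_1^-=0$, $e_D^+=0$ and $$e_i^-=\frac{4i-1-2D}{6-8i+4D}\ (2\le i\le D),\qquad e_i^+=\frac{4i-5-2D}{6-8i+4D}\ (1\le i\le D-1),$$ $$f_i=-(4i-5)(4i-1)+(16i-12)D-4D^2\ (1\le i\le D);$$ the denominators $6-8i+4D$ $(1\le i\le D)$ are nonzero, and so are $e_i^-$ for $2\le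 i\le D$ and $e_i^+$ for $1\le i\le D-1$. Let $U$ be the tridiagonal $D\times D$ matrix with rows and columns indexed by $1,\dots,D$, diagonal entries $1$, $(i,i-1)$-entries $e_i^-$ and $(i,i+1)$-entries $e_i^+$, and for $1\le s\le t\le D$ let $U_{s,t}$ be its principal submatrix on the indices $s,\dots,t$. Then $$\det(U_{s,t})=\frac{(t-s+2)(2D-2t-2s+3)\prod_{k=0}^{t-s-1}(2D-4t+5+4k)}{2^{\,t-s+1}\prod_{k=0}^{t-s}(2D-4t+3+4k)}\neq 0,$$ where the denominator is nonzero. In particular, $(U,(f_i)_{i=1}^D)$ is a strongly uniform structure with respect to $x$ of the connected bipartite graph $\Gamma_f$ obtained from the connected non-bipartite graph $\Gamma$ by deleting all edges $yz$ with $\partial(x,y)=\partial(x,z)$; that is, $\Gamma$ supports a strongly uniform structure with respect to $x$. Here, for a finite connected bipartite graph and a vertex $x$ of eccentricity $\varepsilon$, with $L$, $R$ and $E_i^*$ defined as above but from that graph and with $\varepsilon$ in place of $D$, a uniform structure with respect to $x$ is a pair $(U,f)$ of a complex tridiagonal $\varepsilon\times\varepsilon$ matrix $U=(e_{ij})_{1\le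 i,j\le\varepsilon}$ and a vector $f\in\mathbb C^\varepsilon$ such that $e_{ii}=1$ for all $i$; either $e_{i,i-1}\ne0$ for all $2\le i\le\varepsilon$, or $e_{i-1,i}\neq 0$ for all $2\le i\le\varepsilon$; the principal submatrix of $U$ on the indices $s,\dots,t$ is nonsingular for all $1\le s\le t\le\varepsilon$; and $e_i^-RL^2+LRL+e_i^+L^2R=f_iL$ on $E_i^*V$ for $1\le i\le\varepsilon$, where $e_i^-=e_{i,i-1}$ for $i\ge 2$, $e_i^+=e_{i,i+1}$ for $i\le\varepsilon-1$, and $e_1^-=e_\varepsilon^+=0$. It is strongly uniform if moreover $e_i^-\ne0$ for $2\le i\le\varepsilon$ and $e_i^+\ne0$ for $1\le i\le\varepsilon-1$. -/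

import Mathlib

open scoped Matrix

noncomputable section

/-! ## Lowering, raising matrices and uniform structures -/

namespace UniformGraph

/-- The eccentricity `ε(x)` of a vertex (as a natural number; all graphs of interest are finite
and connected). -/
def ecc {X : Type*} (G : SimpleGraph X) (x : X) : ℕ := (G.eccent x).toNat

/-- The adjacency matrix over `ℂ`. -/
def adj {X : Type*} (G : SimpleGraph X) : Matrix X X ℂ :=
  open Classical in G.adjMatrix ℂ

/-- The `i`-th dual idempotent `E*_i` with respect to `x`. -/
def dualIdempotent {X : Type*} [DecidableEq X] (G : SimpleGraph X) (x : X) (i : ℕ) :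
    Matrix X X ℂ :=
  Matrix.diagonal fun y => if G.dist x y = i then 1 else 0

/-- The lowering matrix `L = ∑_{i=1}^{ε} E*_{i-1} A E*_i`. -/
def lowering {X : Type*} [Fintype X] [DecidableEq X] (G : SimpleGraph X) (x : X) :
    Matrix X X ℂ :=
  ∑ i ∈ Finset.Icc 1 (ecc G x), dualIdempotent G x (i - 1) * adj G * dualIdempotent G x i

/-- The raising matrix `R = ∑_{i=0}^{ε-1} E*_{i+1} A E*_i`. -/
def raising {X : Type*} [Fintype X] [DecidableEq X] (G : SimpleGraph X) (x : X) :
    Matrix X X ℂ :=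
  ∑ i ∈ Finset.range (ecc G x), dualIdempotent G x (i + 1) * adj G * dualIdempotent G x i

/-- The subconstituent `E*_i V`, where `V = ℂ^X` is the standard module. -/
def subconstituent {X : Type*} [Fintype X] [DecidableEq X] (G : SimpleGraph X) (x : X) (i : ℕ) :
    Submodule ℂ (X → ℂ) :=
  LinearMap.range (dualIdempotent G x i).mulVecLin

/-- The relation `e⁻ R L² + L R L + e⁺ L² R = f L` is satisfied on `E*_i V`. -/
def UniformRelationOn {X : Type*} [Fintype X] [DecidableEq X] (G : SimpleGraph X) (x : X) (i : ℕ)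
    (eMinus ePlus f : ℂ) : Prop :=
  ∀ v ∈ subconstituent G x i,
    (eMinus • (raising G x * lowering G x ^ 2) + lowering G x * raising G x * lowering G x
      + ePlus • (lowering G x ^ 2 * raising G x)) *ᵥ v = (f • lowering G x) *ᵥ v

/-- The principal submatrix `(e_{ij})_{s ≤ i, j ≤ t}` of a matrix with indices `1, …, ε`. -/
def principalSubmatrix {ε : ℕ} (U : Matrix (Finset.Icc 1 ε) (Finset.Icc 1 ε) ℂ) (s t : ℕ) :
    Matrix {i : Finset.Icc 1 ε // s ≤ i.1 ∧ i.1 ≤ t} {i : Finset.Icc 1 ε // s ≤ i.1 ∧ i.1 ≤ t} ℂ :=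
  U.submatrix Subtype.val Subtype.val

/-- `e_i⁻ = e_{i,i-1}` for `2 ≤ i ≤ ε`, and `e_1⁻ = 0`. -/
def eMinus {ε : ℕ} (U : Matrix (Finset.Icc 1 ε) (Finset.Icc 1 ε) ℂ) (i : ℕ) : ℂ :=
  if h : 2 ≤ i ∧ i ≤ ε then
    U ⟨i, Finset.mem_Icc.2 (by omega)⟩ ⟨i - 1, Finset.mem_Icc.2 (by omega)⟩ else 0

/-- `e_i⁺ = e_{i,i+1}` for `1 ≤ i ≤ ε - 1`, and `e_ε⁺ = 0`. -/
def ePlus {ε : ℕ} (U : Matrix (Finset.Icc 1 ε) (Finset.Icc 1 ε) ℂ) (i : ℕ) : ℂ :=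
  if h : 1 ≤ i ∧ i + 1 ≤ ε then
    U ⟨i, Finset.mem_Icc.2 (by omega)⟩ ⟨i + 1, Finset.mem_Icc.2 (by omega)⟩ else 0

/-- Parameter matrices with indices `1, …, ε`. -/
structure IsParameterMatrix {ε : ℕ} (U : Matrix (Finset.Icc 1 ε) (Finset.Icc 1 ε) ℂ) : Prop where
  tridiagonal : ∀ i j : Finset.Icc 1 ε, (i.1 + 1 < j.1 ∨ j.1 + 1 < i.1) → U i j = 0
  diag : ∀ i, U i i = 1
  offDiag : (∀ i, 2 ≤ i → i ≤ ε → eMinus U i ≠ 0) ∨ (∀ i, 2 ≤ i → i ≤ ε → ePlus U (i - 1) ≠ 0)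
  nonsingular : ∀ s t, 1 ≤ s → s ≤ t → t ≤ ε → (principalSubmatrix U s t).det ≠ 0

/-- `(U, f)` is a uniform structure, with respect to `x`, of the (connected) bipartite graph `G`.
The size `ε` of `U` and of `f` is the eccentricity of `x`. -/
structure IsUniformStructure {X : Type*} [Fintype X] [DecidableEq X] (G : SimpleGraph X) (x : X)
    {ε : ℕ} (U : Matrix (Finset.Icc 1 ε) (Finset.Icc 1 ε) ℂ) (f : Finset.Icc 1 ε → ℂ) : Prop where
  connected : G.Connected
  bipartite : G.IsBipartite
  ecc_eq : ecc G x = ε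
  isParameterMatrix : IsParameterMatrix U
  relation : ∀ i : Finset.Icc 1 ε, UniformRelationOn G x i.1 (eMinus U i.1) (ePlus U i.1) (f i)

/-- Strongly uniform structures. -/
structure IsStronglyUniformStructure {X : Type*} [Fintype X] [DecidableEq X] (G : SimpleGraph X)
    (x : X) {ε : ℕ} (U : Matrix (Finset.Icc 1 ε) (Finset.Icc 1 ε) ℂ) (f : Finset.Icc 1 ε → ℂ) :
    Prop extends IsUniformStructure G x U f where
  eMinus_ne_zero : ∀ i, 2 ≤ i → i ≤ ε → eMinus U i ≠ 0
  ePlus_ne_zero : ∀ i, 1 ≤ i → i + 1 ≤ ε → ePlus U i ≠ 0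

/-- The graph `Γ_f(x)`: delete from `Γ` all edges `yz` with `∂(x,y) = ∂(x,z)`. -/
def flatFree {X : Type*} (G : SimpleGraph X) (x : X) : SimpleGraph X where
  Adj y z := G.Adj y z ∧ G.dist x y ≠ G.dist x z
  symm := ⟨fun _ _ h => ⟨h.1.symm, h.2.symm⟩⟩
  loopless := ⟨fun _ h => h.2 rfl⟩

/-- A connected non-bipartite graph `G` supports a strongly uniform structure with respect to `x`
if `Γ_f(x)` admits one. -/
def SupportsStronglyUniformStructure {X : Type*} [Fintype X] [DecidableEq X] (G : SimpleGraph X)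
    (x : X) : Prop :=
  G.Connected ∧ ¬ G.IsBipartite ∧
    ∃ (ε : ℕ) (U : Matrix (Finset.Icc 1 ε) (Finset.Icc 1 ε) ℂ) (f : Finset.Icc 1 ε → ℂ),
      IsStronglyUniformStructure (flatFree G x) x U f

/-- The tridiagonal matrix with indices `1, …, ε`, ones on the diagonal, `(i, i-1)`-entry `a i`
and `(i, i+1)`-entry `b i`. -/
def tridiagonal (ε : ℕ) (a b : ℕ → ℂ) : Matrix (Finset.Icc 1 ε) (Finset.Icc 1 ε) ℂ :=
  Matrix.of fun i j =>
    if i.1 = j.1 then 1 else if i.1 = j.1 + 1 then a i.1 else if j.1 = i.1 + 1 then b i.1 else 0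

end UniformGraph

/-! ## The halved cube -/

namespace HalvedCube

/-- The binary words of length `n` of even weight. -/
abbrev Vertex (n : ℕ) : Type := {v : Fin n → ZMod 2 // Even (hammingNorm v)}

/-- The halved cube `½H(n,2)`: words of even weight, adjacent when at Hamming distance two. -/
def graph (n : ℕ) : SimpleGraph (Vertex n) where
  Adj u v := hammingDist u.1 v.1 = 2
  symm := ⟨fun u v h => by rw [hammingDist_comm]; exact h⟩
  loopless := ⟨fun u h => by simp at h⟩

/-- `e_i⁻ = (4i-1-2D)/(6-8i+4D)` for `2 ≤ i ≤ D`, and `0` for other `i`. -/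
def eMinus (D i : ℕ) : ℂ :=
  if 2 ≤ i ∧ i ≤ D then (4 * (i : ℂ) - 1 - 2 * (D : ℂ)) / (6 - 8 * (i : ℂ) + 4 * (D : ℂ)) else 0

/-- `e_i⁺ = (4i-5-2D)/(6-8i+4D)` for `1 ≤ i ≤ D-1`, and `0` for other `i`. -/
def ePlus (D i : ℕ) : ℂ :=
  if 1 ≤ i ∧ i + 1 ≤ D then
    (4 * (i : ℂ) - 5 - 2 * (D : ℂ)) / (6 - 8 * (i : ℂ) + 4 * (D : ℂ)) else 0

/-- `f_i = -(4i-5)(4i-1) + (16i-12)D - 4D²`. -/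
def fCoeff (D i : ℕ) : ℂ :=
  -(4 * (i : ℂ) - 5) * (4 * (i : ℂ) - 1) + (16 * (i : ℂ) - 12) * (D : ℂ) - 4 * (D : ℂ) ^ 2

/-- The parameter matrix `U` with indices `1, …, D`, formed from the `e_i⁻` and `e_i⁺`. -/
def paramMatrix (D : ℕ) : Matrix (Finset.Icc 1 D) (Finset.Icc 1 D) ℂ :=
  UniformGraph.tridiagonal D (eMinus D) (ePlus D)

end HalvedCube

end

/-! Identify a vertex `y` with the set `diffSet x y` of positions where it differs from `x`. This
embeds the vertices into the Boolean lattice of subsets of the `n` positions as the even sets, and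
distance from `x` becomes half the cardinality. Lowering or raising a vertex means adding to or
removing from the argument set an unordered pair, so `L` and `R` are half the squares of the lattice
operators `low` and `up` (`lowering_mulVec`, `raising_mulVec`).

These operators satisfy the sl₂ relation `low_up`: on sets of size `k` their commutator is the
scalar `n - 2k`. Normal ordering (all `up` to the left) turns `RL²`, `LRL` and `L²R` on level `2i`
into combinations of `up² low⁴`, `up low³` and `low²`. Cancelling the first two fixes `e⁻` and `e⁺`,
and the third gives `f` (`uniform_relation`).

The minors are continuants. Their three-term recurrence has a closed-form solution
(`det_finTridiagonal_eq`), nonzero because its factors are odd integers, apart from `t - s + 2 > 0`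
and powers of two. Finally, flat edges affect neither distances from `x` nor `L` and `R`, so
everything transfers to `flatFree`. -/

noncomputable section

/-! ### Continuants: principal minors of tridiagonal matrices. -/

namespace UniformGraph

/-- The tridiagonal matrix of size `m` with unit diagonal, superdiagonal `a` and subdiagonal `b`. -/
def finTridiagonal (m : ℕ) (a b : ℕ → ℂ) : Matrix (Fin m) (Fin m) ℂ :=
  Matrix.of fun i j =>
    if i.1 = j.1 then 1 else if j.1 = i.1 + 1 then a i.1 else if i.1 = j.1 + 1 then b j.1 else 0

/-- The three-term recurrence of continuants. -/
theorem det_finTridiagonal_succ_succ (m : ℕ) (a b : ℕ → ℂ) :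
    (finTridiagonal (m + 2) a b).det =
      (finTridiagonal (m + 1) (fun i => a (i + 1)) (fun i => b (i + 1))).det -
        a 0 * b 0 * (finTridiagonal m (fun i => a (i + 2)) (fun i => b (i + 2))).det := by
  have h0 : (finTridiagonal (m + 2) a b).submatrix Fin.succ (Fin.succAbove 0) =
      finTridiagonal (m + 1) (fun i => a (i + 1)) (fun i => b (i + 1)) := by
    ext i j
    simp [finTridiagonal]
  -- With row 0 and column 1 deleted, the only nonzero entry that can remain in the first column is
  -- `b 0` at the top.
  have h1 : ((finTridiagonal (m + 2) a b).submatrix Fin.succ (Fin.succAbove 1)).det =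
      b 0 * (finTridiagonal m (fun i => a (i + 2)) (fun i => b (i + 2))).det := by
    rw [Matrix.det_succ_column_zero, Fin.sum_univ_succ, Finset.sum_eq_zero, add_zero]
    · congr 1
      · simp [finTridiagonal]
      · congr 1
        ext i j
        simp [finTridiagonal]
    · intro i _
      simp [finTridiagonal]
  rw [Matrix.det_succ_row_zero, Fin.sum_univ_succ, Fin.sum_univ_succ, Finset.sum_eq_zero, add_zero,
    h0, Fin.succ_zero_eq_one, h1]
  · simp [finTridiagonal]
    ring
  · intro i _
    simp [finTridiagonal]

/-- The continuants of the coefficients in the halved cube, in closed form. -/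
theorem det_finTridiagonal_eq (m : ℕ) (a b : ℕ → ℂ) (c : ℂ) (hc : ∀ k : ℕ, c + 1 + 2 * k ≠ 0)
    (hab : ∀ i, i + 1 < m → a i * b i =
      (c + 1 + 4 * i) * (c + 9 + 4 * i) / (4 * (c + 3 + 4 * i) * (c + 7 + 4 * i))) :
    (finTridiagonal m a b).det = (m + 1) * (c + 2 * m + 1) *
      (∏ k ∈ Finset.range m, (c + 1 + 4 * (k : ℂ))) /
        (2 ^ m * (c + 1) * ∏ k ∈ Finset.range m, (c + 3 + 4 * (k : ℂ))) := by
  -- Removing one or two leading indices replaces `c` by `c + 4` or `c + 8`, and `hc` survives both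
  -- shifts. The factor `c + 1` in the denominator cancels the first factor of the numerator
  -- product; keeping it makes one formula serve for `m = 0` as well.
  induction m using Nat.twoStepInduction generalizing a b c with
  | zero =>
    have := hc 0
    simp at this ⊢
    field_simp
  | one =>
    have h1 := hc 0
    have h3 := hc 1
    simp [finTridiagonal] at *
    have : c + 3 ≠ 0 := by convert h3 using 1; ring
    field_simp
    ring
  | more m ih0 ih1 =>
    have e : ∀ j : ℕ, c + (2 * j + 1) ≠ 0 := fun j => by convert hc j using 1; ring
    rw [det_finTridiagonal_succ_succ, hab 0 (by omega),
      ih0 _ _ (c + 8) (fun k => by convert e (4 + k) using 1; push_cast; ring),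
      ih1 _ _ (c + 4) (fun k => by convert e (2 + k) using 1; push_cast; ring)]
    · have P1 : ∏ k ∈ Finset.range (m + 2), (c + 1 + 4 * (k : ℂ)) =
          (c + 1) * (c + 5) * ∏ k ∈ Finset.range m, (c + 8 + 1 + 4 * (k : ℂ)) := by
        rw [Finset.prod_range_succ', Finset.prod_range_succ', mul_assoc, mul_comm]
        congr 1
        · push_cast; ring
        · exact Finset.prod_congr rfl fun k _ => by push_cast; ring
      have P2 : ∏ k ∈ Finset.range (m + 2), (c + 3 + 4 * (k : ℂ)) =
          (c + 3) * (c + 7) * ∏ k ∈ Finset.range m, (c + 8 + 3 + 4 * (k : ℂ)) := by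
        rw [Finset.prod_range_succ', Finset.prod_range_succ', mul_assoc, mul_comm]
        congr 1
        · push_cast; ring
        · exact Finset.prod_congr rfl fun k _ => by push_cast; ring
      have P3 : ∏ k ∈ Finset.range (m + 1), (c + 4 + 1 + 4 * (k : ℂ)) =
          (c + 5) * ∏ k ∈ Finset.range m, (c + 8 + 1 + 4 * (k : ℂ)) := by
        rw [Finset.prod_range_succ', mul_comm]
        congr 1
        · push_cast; ring
        · exact Finset.prod_congr rfl fun k _ => by push_cast; ring
      have P4 : ∏ k ∈ Finset.range (m + 1), (c + 4 + 3 + 4 * (k : ℂ)) =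
          (c + 7) * ∏ k ∈ Finset.range m, (c + 8 + 3 + 4 * (k : ℂ)) := by
        rw [Finset.prod_range_succ', mul_comm]
        congr 1
        · push_cast; ring
        · exact Finset.prod_congr rfl fun k _ => by push_cast; ring
      rw [P1, P2, P3, P4]
      have hQ : ∏ k ∈ Finset.range m, (c + 8 + 3 + 4 * (k : ℂ)) ≠ 0 :=
        Finset.prod_ne_zero_iff.2 fun k _ => by
          convert e (5 + 2 * k) using 1; push_cast; ring
      generalize ∏ k ∈ Finset.range m, (c + 8 + 3 + 4 * (k : ℂ)) = Q at *
      generalize ∏ k ∈ Finset.range m, (c + 8 + 1 + 4 * (k : ℂ)) = P at *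
      have h1 : c + 1 ≠ 0 := by simpa using e 0
      have h3 : c + 3 ≠ 0 := by convert e 1 using 1; push_cast; ring
      have h5 : c + 4 + 1 ≠ 0 := by convert e 2 using 1; push_cast; ring
      have h7 : c + 7 ≠ 0 := by convert e 3 using 1; push_cast; ring
      have h9 : c + 8 + 1 ≠ 0 := by convert e 4 using 1; push_cast; ring
      push_cast
      simp only [mul_zero, add_zero]
      field_simp
      ring
    · intro i hi
      rw [hab (i + 1) (by omega)]
      push_cast
      ring_nf
    · intro i hi
      rw [hab (i + 2) (by omega)]
      push_cast
      ring_nf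

/-- The indices are reversed by `i ↦ t - i`, so that the continuant recurrence strips indices from
the `t` end; this matches the products in the determinant formula, which start at `t`. -/
theorem det_principalSubmatrix_tridiagonal (ε s t : ℕ) (a b : ℕ → ℂ) (hs : 1 ≤ s) (hst : s ≤ t)
    (ht : t ≤ ε) :
    (principalSubmatrix (tridiagonal ε a b) s t).det =
      (finTridiagonal (t - s + 1) (fun i => a (t - i)) (fun i => b (t - i - 1))).det := by
  let e : Fin (t - s + 1) ≃ {i : Finset.Icc 1 ε // s ≤ i.1 ∧ i.1 ≤ t} :=
    { toFun := fun i => ⟨⟨t - i.1, Finset.mem_Icc.2 (by omega)⟩, by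
        change s ≤ t - i.1 ∧ t - i.1 ≤ t; omega⟩
      invFun := fun j => ⟨t - j.1.1, by have := j.2; omega⟩
      left_inv := fun i => by ext; simp only; omega
      right_inv := fun j => by
        have := j.2
        apply Subtype.ext; apply Subtype.ext
        simp only; omega }
  rw [← Matrix.det_submatrix_equiv_self e]
  congr 1
  ext i j
  have hi := i.2
  have hj := j.2
  have h : ∀ i, (e i).1.1 = t - i.1 := fun i => rfl
  simp only [principalSubmatrix, tridiagonal, finTridiagonal, Matrix.submatrix_apply,
    Matrix.of_apply, h]
  by_cases h1 : i.1 = j.1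
  · simp [h1]
  by_cases h2 : j.1 = i.1 + 1
  · rw [if_neg (by omega), if_pos (by omega), if_neg h1, if_pos h2]
  by_cases h3 : i.1 = j.1 + 1
  · rw [if_neg (by omega), if_neg (by omega), if_pos (by omega), if_neg h1, if_neg h2, if_pos h3]
    congr 1; omega
  · rw [if_neg (by omega), if_neg (by omega), if_neg (by omega), if_neg h1, if_neg h2, if_neg h3]

end UniformGraph

/-! ### The parameter matrix of the halved cube. -/

namespace HalvedCube

/-- Parity is the source of nearly all the nonvanishing: the linear factors in the coefficients and
determinants are odd integers, up to powers of two. -/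
theorem intCast_ne_zero_of_odd {z : ℂ} (m : ℤ) (hm : Odd m) (h : z = m) : z ≠ 0 := by
  rw [h]
  rw [Int.cast_ne_zero]
  rintro rfl
  exact absurd hm (by decide)

theorem denominator_ne_zero (D i : ℕ) : (6 - 8 * (i : ℂ) + 4 * (D : ℂ)) ≠ 0 := by
  have h : (3 - 4 * (i : ℂ) + 2 * (D : ℂ)) ≠ 0 :=
    intCast_ne_zero_of_odd (3 - 4 * i + 2 * D) ⟨1 - 2 * i + D, by ring⟩ (by push_cast; ring)
  intro h'
  exact h (by linear_combination h' / 2)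

theorem eMinus_ne_zero {D i : ℕ} (h2 : 2 ≤ i) (hi : i ≤ D) : eMinus D i ≠ 0 := by
  rw [eMinus, if_pos ⟨h2, hi⟩]
  exact div_ne_zero (intCast_ne_zero_of_odd (4 * i - 1 - 2 * D) ⟨2 * i - 1 - D, by ring⟩
    (by push_cast; ring)) (denominator_ne_zero D i)

theorem ePlus_ne_zero {D i : ℕ} (h1 : 1 ≤ i) (hi : i + 1 ≤ D) : ePlus D i ≠ 0 := by
  rw [ePlus, if_pos ⟨h1, hi⟩]
  exact div_ne_zero (intCast_ne_zero_of_odd (4 * i - 5 - 2 * D) ⟨2 * i - 3 - D, by ring⟩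
    (by push_cast; ring)) (denominator_ne_zero D i)

theorem eMinus_paramMatrix {D i : ℕ} :
    UniformGraph.eMinus (paramMatrix D) i = eMinus D i := by
  unfold UniformGraph.eMinus
  split_ifs with h
  · simp only [paramMatrix, UniformGraph.tridiagonal, Matrix.of_apply]
    rw [if_neg (by omega), if_pos (by omega)]
  · rw [eMinus, if_neg h]

theorem ePlus_paramMatrix {D i : ℕ} :
    UniformGraph.ePlus (paramMatrix D) i = ePlus D i := by
  unfold UniformGraph.ePlus
  split_ifs with h
  · simp only [paramMatrix, UniformGraph.tridiagonal, Matrix.of_apply]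
    rw [if_neg (by omega), if_neg (by omega), if_pos True.intro]
  · rw [ePlus, if_neg h]

theorem odd_prod_ne_zero (D t m j : ℕ) (hj : Odd j) :
    (∏ k ∈ Finset.range m, (2 * (D : ℂ) - 4 * (t : ℂ) + j + 4 * (k : ℂ))) ≠ 0 := by
  obtain ⟨l, rfl⟩ := hj
  exact Finset.prod_ne_zero_iff.2 fun k _ =>
    intCast_ne_zero_of_odd (2 * D - 4 * t + (2 * l + 1) + 4 * k) ⟨D - 2 * t + l + 2 * k, by ring⟩
      (by push_cast; ring)

theorem det_principalSubmatrix_paramMatrix {D s t : ℕ} (hs : 1 ≤ s) (hst : s ≤ t) (ht : t ≤ D) :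
    (UniformGraph.principalSubmatrix (paramMatrix D) s t).det =
      (((t : ℂ) - (s : ℂ) + 2) * (2 * (D : ℂ) - 2 * (t : ℂ) - 2 * (s : ℂ) + 3) *
        ∏ k ∈ Finset.range (t - s), (2 * (D : ℂ) - 4 * (t : ℂ) + 5 + 4 * (k : ℂ))) /
      (2 ^ (t - s + 1) *
        ∏ k ∈ Finset.range (t - s + 1), (2 * (D : ℂ) - 4 * (t : ℂ) + 3 + 4 * (k : ℂ))) := by
  rw [paramMatrix, UniformGraph.det_principalSubmatrix_tridiagonal D s t _ _ hs hst ht,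
    UniformGraph.det_finTridiagonal_eq _ _ _ (2 * (D : ℂ) - 4 * (t : ℂ))]
  · have h1 : 2 * (D : ℂ) - 4 * (t : ℂ) + 1 ≠ 0 :=
      intCast_ne_zero_of_odd (2 * D - 4 * t + 1) ⟨D - 2 * t, by ring⟩ (by push_cast; ring)
    have h3 := odd_prod_ne_zero D t (t - s + 1) 3 (by decide)
    push_cast at h3
    -- Splitting off the factor `k = 0` cancels `c + 1` and shifts the remaining product from `1 +
    -- 4k` to `5 + 4k`.
    rw [Finset.prod_range_succ' (fun k : ℕ => 2 * (D : ℂ) - 4 * (t : ℂ) + 1 + 4 * (k : ℂ))]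
    have h5 : ∏ k ∈ Finset.range (t - s), (2 * (D : ℂ) - 4 * (t : ℂ) + 1 + 4 * ((k + 1 : ℕ) : ℂ)) =
        ∏ k ∈ Finset.range (t - s), (2 * (D : ℂ) - 4 * (t : ℂ) + 5 + 4 * (k : ℂ)) :=
      Finset.prod_congr rfl fun k _ => by push_cast; ring
    rw [h5]
    generalize ∏ k ∈ Finset.range (t - s), (2 * (D : ℂ) - 4 * (t : ℂ) + 5 + 4 * (k : ℂ)) = P
    generalize ∏ k ∈ Finset.range (t - s + 1), (2 * (D : ℂ) - 4 * (t : ℂ) + 3 + 4 * (k : ℂ)) = Q at *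
    push_cast [Nat.cast_sub hst]
    rw [div_eq_div_iff (mul_ne_zero (mul_ne_zero (by simp) h1) h3) (mul_ne_zero (by simp) h3)]
    ring
  · exact fun k => intCast_ne_zero_of_odd (2 * D - 4 * t + 1 + 2 * k) ⟨D - 2 * t + k, by ring⟩
      (by push_cast; ring)
  -- With `c = 2D - 4t`, the numerators of `e⁻` at `t - i` and `e⁺` at `t - i - 1` are `-(c + 1 +
  -- 4i)` and `-(c + 9 + 4i)`; the signs cancel. Both indices lie in the range where the
  -- coefficients are not set to `0`.
  · intro i hi
    have d1 := denominator_ne_zero D (t - i)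
    have d2 := denominator_ne_zero D (t - i - 1)
    rw [eMinus, ePlus, if_pos (by omega), if_pos (by omega), div_mul_div_comm]
    have h : ((t - i - 1 : ℕ) : ℂ) = t - i - 1 := by
      rw [Nat.cast_sub (by omega), Nat.cast_sub (by omega), Nat.cast_one]
    have h' : ((t - i : ℕ) : ℂ) = t - i := Nat.cast_sub (by omega)
    rw [h, h']
    congr 1 <;> ring

theorem det_principalSubmatrix_paramMatrix_ne_zero {D s t : ℕ} (hs : 1 ≤ s) (hst : s ≤ t)
    (ht : t ≤ D) : (UniformGraph.principalSubmatrix (paramMatrix D) s t).det ≠ 0 := by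
  rw [det_principalSubmatrix_paramMatrix hs hst ht]
  have h3 := odd_prod_ne_zero D t (t - s + 1) 3 (by decide)
  have h5 := odd_prod_ne_zero D t (t - s) 5 (by decide)
  push_cast at h3 h5
  refine div_ne_zero (mul_ne_zero (mul_ne_zero ?_ ?_) h5) (mul_ne_zero (by simp) h3)
  · rw [← Nat.cast_sub hst]
    exact_mod_cast Nat.succ_ne_zero (t - s + 1)
  · exact intCast_ne_zero_of_odd (2 * D - 2 * t - 2 * s + 3) ⟨D - t - s + 1, by ring⟩
      (by push_cast; ring)

theorem isParameterMatrix_paramMatrix (D : ℕ) :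
    UniformGraph.IsParameterMatrix (paramMatrix D) where
  tridiagonal i j h := by
    simp only [paramMatrix, UniformGraph.tridiagonal, Matrix.of_apply]
    rw [if_neg (by omega), if_neg (by omega), if_neg (by omega)]
  diag i := by simp [paramMatrix, UniformGraph.tridiagonal]
  offDiag := Or.inl fun i h2 hi => by
    rw [eMinus_paramMatrix]
    exact eMinus_ne_zero h2 hi
  nonsingular _ _ := det_principalSubmatrix_paramMatrix_ne_zero

end HalvedCube

/-! ### Deleting the flat edges preserves distances from `x`, `L` and `R`. -/

namespace UniformGraph

variable {X : Type*} {G : SimpleGraph X} {x : X}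

theorem eccent_ne_top [Finite X] (hG : G.Connected) (x : X) : G.eccent x ≠ ⊤ := by
  have : Nonempty X := ⟨x⟩
  obtain ⟨y, hy⟩ := G.exists_edist_eq_eccent_of_finite x
  rw [← hy]
  exact SimpleGraph.edist_ne_top_iff_reachable.2 (hG x y)

theorem dist_le_ecc [Finite X] (hG : G.Connected) (x y : X) : G.dist x y ≤ ecc G x :=
  ENat.toNat_le_toNat SimpleGraph.edist_le_eccent (eccent_ne_top hG x)

theorem exists_dist_eq_ecc [Finite X] (G : SimpleGraph X) (x : X) : ∃ y, G.dist x y = ecc G x := by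
  have : Nonempty X := ⟨x⟩
  obtain ⟨y, hy⟩ := G.exists_edist_eq_eccent_of_finite x
  exact ⟨y, congrArg ENat.toNat hy⟩

theorem lowering_apply [Fintype X] [DecidableEq X] (hG : G.Connected) (x y z : X) :
    lowering G x y z = open Classical in
      if G.Adj y z ∧ G.dist x z = G.dist x y + 1 then 1 else 0 := by
  classical
  have hz := dist_le_ecc hG x z
  simp only [lowering, dualIdempotent, adj, Matrix.sum_apply, Matrix.mul_diagonal,
    Matrix.diagonal_mul, SimpleGraph.adjMatrix_apply]
  split_ifs with h h' h'
  · rw [Finset.sum_eq_single_of_mem (G.dist x z) (Finset.mem_Icc.2 (by omega))]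
    · simp [h'.2]
    · intro i _ hi
      simp [Ne.symm hi]
  · refine Finset.sum_eq_zero fun i hi => ?_
    rw [Finset.mem_Icc] at hi
    have : ¬ G.dist x z = G.dist x y + 1 := fun h2 => h' ⟨h, h2⟩
    by_cases h1 : G.dist x z = i
    · rw [if_neg (by omega)]; simp
    · simp [h1]
  · exact absurd h'.1 h
  · simp

theorem raising_apply [Fintype X] [DecidableEq X] (hG : G.Connected) (x y z : X) :
    raising G x y z = open Classical in
      if G.Adj y z ∧ G.dist x y = G.dist x z + 1 then 1 else 0 := by
  classical
  have hz := dist_le_ecc hG x y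
  simp only [raising, dualIdempotent, adj, Matrix.sum_apply, Matrix.mul_diagonal,
    Matrix.diagonal_mul, SimpleGraph.adjMatrix_apply]
  split_ifs with h h' h'
  · rw [Finset.sum_eq_single_of_mem (G.dist x z) (Finset.mem_range.2 (by omega))]
    · simp [h'.2]
    · intro i _ hi
      simp [Ne.symm hi]
  · refine Finset.sum_eq_zero fun i hi => ?_
    have : ¬ G.dist x y = G.dist x z + 1 := fun h2 => h' ⟨h, h2⟩
    by_cases h1 : G.dist x z = i
    · rw [if_neg (by omega)]; simp
    · simp [h1]
  · exact absurd h'.1 h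
  · simp

theorem flatFree_adj {y z : X} :
    (flatFree G x).Adj y z ↔ G.Adj y z ∧ G.dist x y ≠ G.dist x z := Iff.rfl

theorem flatFree_le (G : SimpleGraph X) (x : X) : flatFree G x ≤ G := fun _ _ h => h.1

/-- Along a geodesic from `x` the distance to `x` changes at every step, so none of its edges is
flat. -/
theorem exists_walk_flatFree (hG : G.Connected) (x : X) :
    ∀ (k : ℕ) (y : X), G.dist x y = k → ∃ p : (flatFree G x).Walk x y, p.length = k := by
  intro k
  induction k with
  | zero =>
    intro y hy
    obtain rfl := (hG.dist_eq_zero_iff).1 hy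
    exact ⟨.nil, rfl⟩
  | succ k ih =>
    intro y hy
    obtain ⟨p, hp⟩ := hG.exists_walk_length_eq_dist y x
    rw [SimpleGraph.dist_comm, hy] at hp
    cases p with
    | nil => simp at hp
    | @cons _ z _ h q =>
      simp only [SimpleGraph.Walk.length_cons, Nat.add_right_cancel_iff] at hp
      have h1 : G.dist x z ≤ k := by
        rw [SimpleGraph.dist_comm, ← hp]; exact SimpleGraph.dist_le q
      have h2 := hG.dist_triangle (u := x) (v := z) (w := y)
      rw [SimpleGraph.dist_eq_one_iff_adj.2 h.symm] at h2
      obtain ⟨r, hr⟩ := ih z (by omega)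
      have hzy : (flatFree G x).Adj z y := ⟨h.symm, by omega⟩
      exact ⟨r.concat hzy, by rw [SimpleGraph.Walk.length_concat, hr]⟩

theorem connected_flatFree (hG : G.Connected) (x : X) : (flatFree G x).Connected := by
  have : Nonempty X := ⟨x⟩
  refine SimpleGraph.Connected.mk fun y z => ?_
  obtain ⟨p, -⟩ := exists_walk_flatFree hG x _ y rfl
  obtain ⟨q, -⟩ := exists_walk_flatFree hG x _ z rfl
  exact ⟨p.reverse.append q⟩

theorem dist_flatFree (hG : G.Connected) (x y : X) :
    (flatFree G x).dist x y = G.dist x y := by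
  obtain ⟨p, hp⟩ := exists_walk_flatFree hG x _ y rfl
  refine le_antisymm (hp ▸ SimpleGraph.dist_le p) ?_
  obtain ⟨q, hq⟩ := (connected_flatFree hG x).exists_walk_length_eq_dist x y
  rw [← hq, ← SimpleGraph.Walk.length_mapLe (flatFree_le G x)]
  exact SimpleGraph.dist_le _

theorem isBipartite_flatFree (hG : G.Connected) (x : X) : (flatFree G x).IsBipartite := by
  -- Colour by the parity of the distance to `x`: the surviving edges change that distance by
  -- exactly one.
  refine ⟨SimpleGraph.Coloring.mk (fun y => Fin.ofNat 2 (G.dist x y)) fun {y z} h he => ?_⟩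
  have h1 := hG.dist_triangle (u := x) (v := z) (w := y)
  have h2 := hG.dist_triangle (u := x) (v := y) (w := z)
  rw [SimpleGraph.dist_eq_one_iff_adj.2 h.1] at h2
  rw [SimpleGraph.dist_eq_one_iff_adj.2 h.1.symm] at h1
  have h3 := h.2
  have h4 := congrArg Fin.val he
  simp only [Fin.val_ofNat] at h4
  omega

theorem ecc_flatFree [Finite X] (hG : G.Connected) (x : X) : ecc (flatFree G x) x = ecc G x := by
  obtain ⟨y, hy⟩ := exists_dist_eq_ecc G x
  obtain ⟨z, hz⟩ := exists_dist_eq_ecc (flatFree G x) x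
  refine le_antisymm ?_ ?_
  · rw [← hz, dist_flatFree hG]; exact dist_le_ecc hG x z
  · rw [← hy, ← dist_flatFree hG]; exact dist_le_ecc (connected_flatFree hG x) x y

theorem lowering_flatFree [Fintype X] [DecidableEq X] (hG : G.Connected) (x : X) :
    lowering (flatFree G x) x = lowering G x := by
  ext y z
  rw [lowering_apply hG, lowering_apply (connected_flatFree hG x)]
  classical
  refine if_congr ?_ rfl rfl
  rw [dist_flatFree hG, dist_flatFree hG, flatFree_adj]
  exact ⟨fun h => ⟨h.1.1, h.2⟩, fun h => ⟨⟨h.1, by omega⟩, h.2⟩⟩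

theorem raising_flatFree [Fintype X] [DecidableEq X] (hG : G.Connected) (x : X) :
    raising (flatFree G x) x = raising G x := by
  ext y z
  rw [raising_apply hG, raising_apply (connected_flatFree hG x)]
  classical
  refine if_congr ?_ rfl rfl
  rw [dist_flatFree hG, dist_flatFree hG, flatFree_adj]
  exact ⟨fun h => ⟨h.1.1, h.2⟩, fun h => ⟨⟨h.1, by omega⟩, h.2⟩⟩

theorem uniformRelationOn_flatFree [Fintype X] [DecidableEq X] (hG : G.Connected) (i : ℕ)
    (eM eP f : ℂ) :
    UniformRelationOn (flatFree G x) x i eM eP f ↔ UniformRelationOn G x i eM eP f := by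
  simp only [UniformRelationOn, lowering_flatFree hG, raising_flatFree hG, subconstituent,
    dualIdempotent, dist_flatFree hG]

theorem eq_zero_of_mem_subconstituent [Fintype X] [DecidableEq X] {i : ℕ} {v : X → ℂ}
    (hv : v ∈ subconstituent G x i) {y : X} (hy : G.dist x y ≠ i) : v y = 0 := by
  obtain ⟨u, rfl⟩ := hv
  simp [dualIdempotent, Matrix.mulVec_diagonal, hy]

end UniformGraph

/-! ### The sl₂ relations of the Boolean lattice. -/

namespace BooleanLattice

variable {α : Type*}

/-- The functions supported on the sets of cardinality `k`. -/
def level (α : Type*) (k : ℤ) : Submodule ℂ (Finset α → ℂ) where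
  carrier := {w | ∀ S, (S.card : ℤ) ≠ k → w S = 0}
  add_mem' hv hw S h := by simp [hv S h, hw S h]
  zero_mem' _ _ := rfl
  smul_mem' c w hw S h := by simp [hw S h]

/-- Levels are indexed by `ℤ` so that `low` always shifts by `-1`. Vanishing outside `0, …, n` is
what makes the conventions `e_1⁻ = 0` and `e_D⁺ = 0` harmless. -/
theorem eq_zero_of_mem_level_of_neg {k : ℤ} {w : Finset α → ℂ} (hw : w ∈ level α k) (hk : k < 0) :
    w = 0 := by
  ext S
  exact hw S (by omega)

theorem eq_zero_of_mem_level_of_card_lt [Fintype α] {k : ℤ} {w : Finset α → ℂ} (hw : w ∈ level α k)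
    (hk : (Fintype.card α : ℤ) < k) : w = 0 := by
  ext S
  have := Finset.card_le_univ S
  exact hw S (by omega)

variable [DecidableEq α]

/-- The raising operator of the Boolean lattice. -/
def up : (Finset α → ℂ) →ₗ[ℂ] (Finset α → ℂ) where
  toFun w T := ∑ a ∈ T, w (T.erase a)
  map_add' v w := by ext T; simp [Finset.sum_add_distrib]
  map_smul' c w := by ext T; simp [Finset.mul_sum]

theorem up_apply (w : Finset α → ℂ) (T : Finset α) : up w T = ∑ a ∈ T, w (T.erase a) := rfl

theorem up_mem_level {k : ℤ} {w : Finset α → ℂ} (hw : w ∈ level α k) : up w ∈ level α (k + 1) := by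
  intro T hT
  refine Finset.sum_eq_zero fun a ha => hw _ ?_
  have := Finset.card_erase_add_one ha
  omega

variable [Fintype α]

/-- The lowering operator of the Boolean lattice. -/
def low : (Finset α → ℂ) →ₗ[ℂ] (Finset α → ℂ) where
  toFun w T := ∑ a ∈ Tᶜ, w (insert a T)
  map_add' v w := by ext T; simp [Finset.sum_add_distrib]
  map_smul' c w := by ext T; simp [Finset.mul_sum]

theorem low_apply (w : Finset α → ℂ) (T : Finset α) : low w T = ∑ a ∈ Tᶜ, w (insert a T) := rfl

theorem low_mem_level {k : ℤ} {w : Finset α → ℂ} (hw : w ∈ level α k) : low w ∈ level α (k - 1) := by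
  intro T hT
  refine Finset.sum_eq_zero fun a ha => hw _ ?_
  rw [Finset.card_insert_of_notMem (Finset.mem_compl.1 ha)]
  push_cast
  omega

/-- Both orders produce the same exchanges of one element of `T` with one outside. They differ only
in how often they return to `T`: once per outside element against once per inside element. -/
theorem low_up_apply (w : Finset α → ℂ) (T : Finset α) :
    low (up w) T = up (low w) T + ((Fintype.card α : ℂ) - 2 * T.card) * w T := by
  have h1 : low (up w) T = (Tᶜ.card : ℂ) * w T +
      ∑ a ∈ Tᶜ, ∑ b ∈ T, w ((insert a T).erase b) := by
    rw [low_apply, ← nsmul_eq_mul, ← Finset.sum_const, ← Finset.sum_add_distrib]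
    refine Finset.sum_congr rfl fun a ha => ?_
    have ha := Finset.mem_compl.1 ha
    rw [up_apply, Finset.sum_insert ha, Finset.erase_insert ha]
  have h2 : up (low w) T = (T.card : ℂ) * w T +
      ∑ b ∈ T, ∑ a ∈ Tᶜ, w ((insert a T).erase b) := by
    rw [up_apply, ← nsmul_eq_mul, ← Finset.sum_const, ← Finset.sum_add_distrib]
    refine Finset.sum_congr rfl fun b hb => ?_
    rw [low_apply, Finset.compl_erase, Finset.sum_insert (by simpa using hb), Finset.insert_erase hb]
    congr 1
    refine Finset.sum_congr rfl fun a ha => ?_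
    rw [Finset.erase_insert_of_ne]
    rintro rfl
    exact Finset.mem_compl.1 ha hb
  have h3 : (Tᶜ.card : ℂ) = Fintype.card α - T.card := by
    rw [Finset.card_compl, Nat.cast_sub (Finset.card_le_univ T)]
  rw [h1, h2, Finset.sum_comm, h3]
  ring

theorem low_up {k : ℤ} {w : Finset α → ℂ} (hw : w ∈ level α k) :
    low (up w) = up (low w) + ((Fintype.card α : ℂ) - 2 * k) • w := by
  ext T
  rw [low_up_apply, Pi.add_apply, Pi.smul_apply, smul_eq_mul]
  by_cases h : (T.card : ℤ) = k
  · rw [← h]; push_cast; rfl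
  · rw [hw T h]; simp

theorem low_up_up {k : ℤ} {w : Finset α → ℂ} (hw : w ∈ level α k) :
    low (up (up w)) = up (up (low w)) + (2 * (Fintype.card α : ℂ) - 4 * k - 2) • up w := by
  rw [low_up (up_mem_level hw), low_up hw, map_add, map_smul]
  push_cast
  module

theorem low_low_up_up {k : ℤ} {w : Finset α → ℂ} (hw : w ∈ level α k) :
    low (low (up (up w))) = up (up (low (low w))) +
      (4 * (Fintype.card α : ℂ) - 8 * k) • up (low w) +
      ((2 * (Fintype.card α : ℂ) - 4 * k - 2) * ((Fintype.card α : ℂ) - 2 * k)) • w := by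
  rw [low_up_up hw, map_add, map_smul, low_up hw, low_up_up (low_mem_level hw)]
  push_cast
  module

theorem low_low_low_low_up_up {k : ℤ} {w : Finset α → ℂ} (hw : w ∈ level α k) :
    low (low (low (low (up (up w))))) = up (up (low (low (low (low w))))) +
      (8 * (Fintype.card α : ℂ) - 16 * k + 16) • up (low (low (low w))) +
      (4 * (3 * (Fintype.card α : ℂ) - 6 * k + 6) * ((Fintype.card α : ℂ) - 2 * k + 1)) •
        low (low w) := by
  rw [low_low_up_up hw]
  simp only [map_add, map_smul]
  rw [low_low_up_up (low_mem_level (low_mem_level hw)), low_up (low_mem_level hw), map_add,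
    map_smul, low_up (low_mem_level (low_mem_level hw))]
  push_cast
  module

/-- After normal ordering, `e⁻ + 1 + e⁺ = 0` removes `up² low⁴`, the identity `e1` removes `up
low³`, and `e2` identifies the coefficient of `low²`. The factor 4 comes from `L = low²/2` and `R =
up²/2`. -/
theorem uniform_relation {i D : ℕ} {eM eP : ℂ} (hn : Fintype.card α = 2 * D + 1)
    (hM : eM * (6 - 8 * i + 4 * D) = 4 * i - 1 - 2 * D)
    (hP : eP * (6 - 8 * i + 4 * D) = 4 * i - 5 - 2 * D)
    (hd : (6 - 8 * (i : ℂ) + 4 * D) ≠ 0) {w : Finset α → ℂ} (hw : w ∈ level α (2 * i)) :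
    eM • up (up (low (low (low (low w))))) + low (low (up (up (low (low w))))) +
      eP • low (low (low (low (up (up w))))) = (4 * HalvedCube.fCoeff D i) • low (low w) := by
  rw [low_low_low_low_up_up hw, low_low_up_up (low_mem_level (low_mem_level hw))]
  have h1 : eM = -1 - eP := by
    rw [← sub_eq_zero]
    refine (mul_eq_zero.1 ?_).resolve_right hd
    linear_combination hM + hP
  subst h1
  have e1 : (4 * (Fintype.card α : ℂ) - 8 * (2 * i - 1 - 1)) +
      eP * (8 * (Fintype.card α : ℂ) - 16 * (2 * i) + 16) = 0 := by
    rw [hn]; push_cast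
    linear_combination 4 * hP
  have e2 : (2 * (Fintype.card α : ℂ) - 4 * (2 * i - 1 - 1) - 2) *
        ((Fintype.card α : ℂ) - 2 * (2 * i - 1 - 1)) +
      eP * (4 * (3 * (Fintype.card α : ℂ) - 6 * (2 * i) + 6) *
        ((Fintype.card α : ℂ) - 2 * (2 * i) + 1)) = 4 * HalvedCube.fCoeff D i := by
    rw [hn, HalvedCube.fCoeff]; push_cast
    linear_combination 6 * (2 * D + 1 - 4 * i + 1) * hP
  rw [← e2]
  push_cast
  linear_combination (norm := module) e1 • up (low (low (low w)))

end BooleanLattice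

/-! ### Squares of `up` and `low` as sums over ordered pairs. -/

namespace BooleanLattice

variable {α : Type*} [DecidableEq α]

theorem sum_offDiag_eq_sum_erase (A : Finset α) (g : α × α → ℂ) :
    ∑ p ∈ A.offDiag, g p = ∑ a ∈ A, ∑ b ∈ A.erase a, g (a, b) := by
  rw [Finset.sum_sigma']
  refine Finset.sum_bij' (fun p _ => ⟨p.1, p.2⟩) (fun q _ => (q.1, q.2)) ?_ ?_ ?_ ?_ ?_ <;>
    simp [Finset.mem_offDiag] <;> grind

/-- Writing the removal of a pair as a symmetric difference gives `up²` and `low²` the same shape,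
so that `sum_offDiag` handles both. -/
theorem up_up_apply (w : Finset α → ℂ) (T : Finset α) :
    up (up w) T = ∑ p ∈ T.offDiag, w (symmDiff T {p.1, p.2}) := by
  rw [up_apply, sum_offDiag_eq_sum_erase]
  refine Finset.sum_congr rfl fun a ha => ?_
  rw [up_apply]
  refine Finset.sum_congr rfl fun b hb => ?_
  congr 1
  ext c
  simp only [Finset.mem_symmDiff, Finset.mem_erase, Finset.mem_insert, Finset.mem_singleton] at *
  grind

theorem offDiag_filter_pair_eq (A P : Finset α) (hP : P.card = 2) (hPA : P ⊆ A) :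
    (A.offDiag.filter fun p => P = {p.1, p.2}) = P.offDiag := by
  obtain ⟨a, b, hab, rfl⟩ := Finset.card_eq_two.1 hP
  have ha := hPA (by simp : a ∈ _)
  have hb := hPA (by simp : b ∈ _)
  ext ⟨c, d⟩
  simp only [Finset.mem_filter, Finset.mem_offDiag, Finset.ext_iff, Finset.mem_insert,
    Finset.mem_singleton]
  constructor
  · rintro ⟨⟨-, -, hcd⟩, h⟩
    exact ⟨(h c).2 (Or.inl rfl), (h d).2 (Or.inr rfl), hcd⟩
  · grind

theorem card_offDiag_filter_pair (A P : Finset α) :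
    (A.offDiag.filter fun p => P = {p.1, p.2}).card = if P.card = 2 ∧ P ⊆ A then 2 else 0 := by
  split_ifs with h
  · rw [offDiag_filter_pair_eq A P h.1 h.2, Finset.offDiag_card, h.1]
  · rw [Finset.card_eq_zero, Finset.filter_eq_empty_iff]
    rintro ⟨a, b⟩ hp rfl
    rw [Finset.mem_offDiag] at hp
    refine h ⟨Finset.card_pair hp.2.2, ?_⟩
    intro c
    simp only [Finset.mem_insert, Finset.mem_singleton]
    rintro (rfl | rfl)
    exacts [hp.1, hp.2.1]

theorem card_symmDiff_add (S P : Finset α) :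
    (symmDiff S P).card + 2 * (S ∩ P).card = S.card + P.card := by
  have h1 : (symmDiff S P).card = (S \ P).card + (P \ S).card :=
    Finset.card_union_of_disjoint disjoint_sdiff_sdiff
  have h2 := Finset.card_sdiff_add_card_inter S P
  have h3 := Finset.card_sdiff_add_card_inter P S
  rw [Finset.inter_comm] at h3
  omega

variable [Fintype α]

theorem low_low_apply (w : Finset α → ℂ) (T : Finset α) :
    low (low w) T = ∑ p ∈ Tᶜ.offDiag, w (symmDiff T {p.1, p.2}) := by
  rw [low_apply, sum_offDiag_eq_sum_erase]
  refine Finset.sum_congr rfl fun a ha => ?_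
  rw [low_apply, Finset.compl_insert]
  refine Finset.sum_congr rfl fun b hb => ?_
  congr 1
  ext c
  simp only [Finset.mem_symmDiff, Finset.mem_erase, Finset.mem_insert, Finset.mem_singleton,
    Finset.mem_compl] at *
  grind

end BooleanLattice

/-! ### The halved cube inside the Boolean lattice. -/

namespace HalvedCube

open BooleanLattice

variable {n : ℕ}

/-- The set of positions in which two vertices differ. -/
def diffSet (y z : Vertex n) : Finset (Fin n) := Finset.univ.filter fun a => y.1 a ≠ z.1 a

theorem card_diffSet (y z : Vertex n) : (diffSet y z).card = hammingDist y.1 z.1 := rfl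

theorem graph_adj {y z : Vertex n} : (graph n).Adj y z ↔ (diffSet y z).card = 2 := Iff.rfl

theorem symmDiff_diffSet (x y z : Vertex n) :
    symmDiff (diffSet x y) (diffSet x z) = diffSet y z := by
  have key : ∀ p q r : ZMod 2, (p ≠ q ∧ p = r ∨ p ≠ r ∧ p = q) ↔ q ≠ r := by decide
  ext a
  simpa [diffSet, Finset.mem_symmDiff] using key (x.1 a) (y.1 a) (z.1 a)

theorem diffSet_comm (y z : Vertex n) : diffSet y z = diffSet z y := by
  ext a; simp [diffSet, ne_comm]

theorem diffSet_eq_symmDiff (x y z : Vertex n) :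
    diffSet x z = symmDiff (diffSet x y) (diffSet y z) := by
  rw [diffSet_comm x y, symmDiff_diffSet]

theorem diffSet_injective (x : Vertex n) : Function.Injective (diffSet x) := by
  intro y z h
  have h0 := symmDiff_diffSet x y z
  rw [h, symmDiff_self] at h0
  have h1 : hammingDist y.1 z.1 = 0 := by
    rw [← card_diffSet, ← h0]; rfl
  exact Subtype.ext (hammingDist_eq_zero.1 h1)

theorem natCast_hammingNorm (v : Fin n → ZMod 2) : (hammingNorm v : ZMod 2) = ∑ a, v a := by
  have key : ∀ p : ZMod 2, (if p ≠ 0 then 1 else 0) = p := by decide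
  rw [hammingNorm, Finset.card_filter, Nat.cast_sum]
  exact Finset.sum_congr rfl fun a _ => by rw [Nat.cast_ite, Nat.cast_one, Nat.cast_zero, key]

theorem natCast_hammingDist (v w : Fin n → ZMod 2) :
    (hammingDist v w : ZMod 2) = ∑ a, v a + ∑ a, w a := by
  have key : ∀ p q : ZMod 2, (if p ≠ q then 1 else 0) = p + q := by decide
  rw [hammingDist, Finset.card_filter, Nat.cast_sum, ← Finset.sum_add_distrib]
  exact Finset.sum_congr rfl fun a _ => by rw [Nat.cast_ite, Nat.cast_one, Nat.cast_zero, key]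

theorem sum_eq_zero_iff (v : Fin n → ZMod 2) : ∑ a, v a = 0 ↔ Even (hammingNorm v) := by
  rw [← natCast_hammingNorm, ZMod.natCast_eq_zero_iff_even]

theorem even_card_diffSet (y z : Vertex n) : Even (diffSet y z).card := by
  rw [card_diffSet, ← ZMod.natCast_eq_zero_iff_even, natCast_hammingDist,
    (sum_eq_zero_iff _).2 y.2, (sum_eq_zero_iff _).2 z.2, add_zero]

theorem exists_diffSet_eq (y : Vertex n) (S : Finset (Fin n)) (hS : Even S.card) :
    ∃ z, diffSet y z = S := by
  have key : ∀ p : ZMod 2, p ≠ p + 1 := by decide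
  refine ⟨⟨fun a => y.1 a + if a ∈ S then 1 else 0, ?_⟩, ?_⟩
  · rw [← sum_eq_zero_iff, Finset.sum_add_distrib, (sum_eq_zero_iff _).2 y.2, zero_add,
      Finset.sum_boole, Finset.filter_mem_eq_inter, Finset.univ_inter,
      ZMod.natCast_eq_zero_iff_even]
    exact hS
  · ext a
    by_cases h : a ∈ S <;> simp [diffSet, h]

/-- Each step flips two of the positions where the endpoints still differ. -/
theorem exists_walk_length_eq (k : ℕ) : ∀ y z : Vertex n, (diffSet y z).card = 2 * k →
    ∃ p : (graph n).Walk y z, p.length = k := by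
  induction k with
  | zero =>
    intro y z h
    obtain rfl : y = z := Subtype.ext (hammingDist_eq_zero.1 (by rw [← card_diffSet, h]))
    exact ⟨.nil, rfl⟩
  | succ k ih =>
    intro y z h
    obtain ⟨P, hPS, hP⟩ := Finset.exists_subset_card_eq (show 2 ≤ (diffSet y z).card by omega)
    obtain ⟨u, hu⟩ := exists_diffSet_eq y P (by rw [hP]; decide)
    obtain ⟨p, hp⟩ := ih u z (by
      have h1 := card_symmDiff_add P (diffSet y z)
      rw [← hu, symmDiff_diffSet, hu, Finset.inter_eq_left.2 hPS] at h1
      omega)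
    have hyu : (graph n).Adj y u := graph_adj.2 (by rw [hu, hP])
    exact ⟨.cons hyu p, by rw [SimpleGraph.Walk.length_cons, hp]⟩

theorem card_diffSet_le_of_walk {y z : Vertex n} (p : (graph n).Walk y z) :
    (diffSet y z).card ≤ 2 * p.length := by
  induction p with
  | nil => simp [diffSet]
  | @cons u v w h p ih =>
    have h1 := hammingDist_triangle u.1 v.1 w.1
    have h2 := graph_adj.1 h
    simp only [card_diffSet, SimpleGraph.Walk.length_cons] at *
    omega

theorem connected_graph (n : ℕ) : (graph n).Connected := by
  have : Nonempty (Vertex n) := ⟨⟨0, by simp⟩⟩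
  refine SimpleGraph.Connected.mk fun y z => ?_
  obtain ⟨k, hk⟩ := even_card_diffSet y z
  obtain ⟨p, -⟩ := exists_walk_length_eq k y z (by omega)
  exact ⟨p⟩

theorem two_mul_dist (y z : Vertex n) : 2 * (graph n).dist y z = (diffSet y z).card := by
  obtain ⟨k, hk⟩ := even_card_diffSet y z
  obtain ⟨p, hp⟩ := exists_walk_length_eq k y z (by omega)
  obtain ⟨q, hq⟩ := (connected_graph n).exists_walk_length_eq_dist y z
  have h1 := card_diffSet_le_of_walk q
  have h2 := SimpleGraph.dist_le p
  omega

theorem dist_le_half (y z : Vertex n) : (graph n).dist y z ≤ n / 2 := by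
  have h1 := two_mul_dist y z
  have h2 := Finset.card_le_univ (diffSet y z)
  rw [Fintype.card_fin] at h2
  omega

theorem exists_dist_eq_half (x : Vertex n) : ∃ y, (graph n).dist x y = n / 2 := by
  obtain ⟨P, -, hP⟩ := Finset.exists_subset_card_eq
    (show 2 * (n / 2) ≤ (Finset.univ : Finset (Fin n)).card by
      rw [Finset.card_univ, Fintype.card_fin]; omega)
  obtain ⟨y, hy⟩ := exists_diffSet_eq x P (by rw [hP]; exact even_two_mul _)
  have := two_mul_dist x y
  rw [hy, hP] at this
  exact ⟨y, by omega⟩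

theorem diam_graph (n : ℕ) : (graph n).diam = n / 2 := by
  have : Nonempty (Vertex n) := (connected_graph n).nonempty
  obtain ⟨x⟩ := this
  have : Nonempty (Vertex n) := ⟨x⟩
  obtain ⟨y, z, h⟩ := (graph n).exists_dist_eq_diam
  obtain ⟨u, hu⟩ := exists_dist_eq_half x
  refine le_antisymm (h ▸ dist_le_half y z) (hu ▸ SimpleGraph.dist_le_diam ?_)
  exact SimpleGraph.connected_iff_ediam_ne_top.1 (connected_graph n)

theorem ecc_graph (x : Vertex n) : UniformGraph.ecc (graph n) x = n / 2 := by
  obtain ⟨y, hy⟩ := UniformGraph.exists_dist_eq_ecc (graph n) x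
  obtain ⟨u, hu⟩ := exists_dist_eq_half x
  exact le_antisymm (hy ▸ dist_le_half x y)
    (hu ▸ UniformGraph.dist_le_ecc (connected_graph n) x u)

/-- Flipping `{a, b}` and `{a, d}` in `x` gives two vertices that differ exactly in `{b, d}`, hence
a triangle. -/
theorem not_isBipartite_graph (hn : 3 ≤ n) : ¬ (graph n).IsBipartite := by
  rintro ⟨c⟩
  obtain ⟨x⟩ := (connected_graph n).nonempty
  let a : Fin n := ⟨0, by omega⟩
  let b : Fin n := ⟨1, by omega⟩
  let d : Fin n := ⟨2, by omega⟩
  have hab : a ≠ b := by simp [a, b]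
  have had : a ≠ d := by simp [a, d]
  have hbd : b ≠ d := by simp [b, d]
  obtain ⟨y, hy⟩ := exists_diffSet_eq x {a, b} (by rw [Finset.card_pair hab]; decide)
  obtain ⟨z, hz⟩ := exists_diffSet_eq x {a, d} (by rw [Finset.card_pair had]; decide)
  have h1 := c.valid (graph_adj.2 (by rw [hy, Finset.card_pair hab]))
  have h2 := c.valid (graph_adj.2 (by rw [hz, Finset.card_pair had]))
  have hyz : diffSet y z = {b, d} := by
    rw [← symmDiff_diffSet x, hy, hz]
    ext e
    simp only [Finset.mem_symmDiff, Finset.mem_insert, Finset.mem_singleton]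
    grind
  have h3 := c.valid (graph_adj.2 (by rw [hyz, Finset.card_pair hbd]))
  generalize c x = p at *
  generalize c y = q at *
  generalize c z = r at *
  revert p q r
  decide

/-- Each neighbour `z` of `y` with `diffSet y z ⊆ A` arises from the two orderings of that pair;
this is the origin of the factor `1/2` in `L` and `R`. -/
theorem sum_offDiag (x y : Vertex n) (A : Finset (Fin n)) (w : Finset (Fin n) → ℂ) :
    ∑ p ∈ A.offDiag, w (symmDiff (diffSet x y) {p.1, p.2}) =
      2 * ∑ z, (if (diffSet y z).card = 2 ∧ diffSet y z ⊆ A then 1 else 0) * w (diffSet x z) := by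
  have h : ∀ p ∈ A.offDiag, w (symmDiff (diffSet x y) {p.1, p.2}) =
      ∑ z, (if diffSet y z = {p.1, p.2} then 1 else 0) * w (diffSet x z) := by
    intro p hp
    obtain ⟨z, hz⟩ := exists_diffSet_eq y {p.1, p.2} (by
      rw [Finset.card_pair (Finset.mem_offDiag.1 hp).2.2]; decide)
    rw [Finset.sum_eq_single z]
    · rw [if_pos hz, one_mul, diffSet_eq_symmDiff x y z, hz]
    · intro u _ hu
      rw [if_neg, zero_mul]
      exact fun hu' => hu (diffSet_injective y (hu'.trans hz.symm))
    · simp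
  rw [Finset.sum_congr rfl h, Finset.sum_comm, Finset.mul_sum]
  refine Finset.sum_congr rfl fun z _ => ?_
  rw [← Finset.sum_mul, Finset.sum_boole, card_offDiag_filter_pair]
  split_ifs <;> simp

theorem lowering_mulVec (x : Vertex n) (w : Finset (Fin n) → ℂ) :
    UniformGraph.lowering (graph n) x *ᵥ (w ∘ diffSet x) =
      ((1 / 2 : ℂ) • low (low w)) ∘ diffSet x := by
  ext y
  rw [Function.comp_apply, Pi.smul_apply, low_low_apply, sum_offDiag, smul_eq_mul, ← mul_assoc,
    one_div, inv_mul_cancel₀ two_ne_zero, one_mul]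
  refine Finset.sum_congr rfl fun z _ => ?_
  refine congrArg (· * w (diffSet x z))
    ((UniformGraph.lowering_apply (connected_graph n) x y z).trans ?_)
  classical
  refine if_congr ?_ rfl rfl
  rw [graph_adj]
  refine and_congr_right fun h => ?_
  have h1 := two_mul_dist x y
  have h2 := two_mul_dist x z
  -- Flipping a pair raises the distance to `x` by one exactly when the pair is disjoint from
  -- `diffSet x y`.
  have h3 := card_symmDiff_add (diffSet x y) (diffSet y z)
  rw [← diffSet_eq_symmDiff] at h3
  rw [Finset.subset_compl_comm, Finset.subset_compl_iff_disjoint_right,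
    Finset.disjoint_iff_inter_eq_empty, ← Finset.card_eq_zero]
  omega

theorem raising_mulVec (x : Vertex n) (w : Finset (Fin n) → ℂ) :
    UniformGraph.raising (graph n) x *ᵥ (w ∘ diffSet x) =
      ((1 / 2 : ℂ) • up (up w)) ∘ diffSet x := by
  ext y
  rw [Function.comp_apply, Pi.smul_apply, up_up_apply, sum_offDiag, smul_eq_mul, ← mul_assoc,
    one_div, inv_mul_cancel₀ two_ne_zero, one_mul]
  refine Finset.sum_congr rfl fun z _ => ?_
  refine congrArg (· * w (diffSet x z))
    ((UniformGraph.raising_apply (connected_graph n) x y z).trans ?_)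
  classical
  refine if_congr ?_ rfl rfl
  rw [graph_adj]
  refine and_congr_right fun h => ?_
  have h1 := two_mul_dist x y
  have h2 := two_mul_dist x z
  have h3 := card_symmDiff_add (diffSet x y) (diffSet y z)
  rw [← diffSet_eq_symmDiff] at h3
  rw [← Finset.inter_eq_right]
  have h4 : diffSet x y ∩ diffSet y z = diffSet y z ↔
      (diffSet x y ∩ diffSet y z).card = (diffSet y z).card :=
    ⟨fun h => by rw [h], fun h => Finset.eq_of_subset_of_card_le Finset.inter_subset_right h.ge⟩
  rw [h4]
  omega

/-- Extension by zero to the sets not of the form `diffSet x y` lets the lattice operators act,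
including through the odd levels. -/
theorem exists_level_comp_diffSet {x : Vertex n} {i : ℕ} {v : Vertex n → ℂ}
    (hv : v ∈ UniformGraph.subconstituent (graph n) x i) :
    ∃ w ∈ level (Fin n) (2 * i), v = w ∘ diffSet x := by
  refine ⟨Function.extend (diffSet x) v 0, fun S hS => ?_,
    funext fun y => ((diffSet_injective x).extend_apply v 0 y).symm⟩
  by_cases h : ∃ y, diffSet x y = S
  · obtain ⟨y, rfl⟩ := h
    rw [(diffSet_injective x).extend_apply]
    refine UniformGraph.eq_zero_of_mem_subconstituent hv fun hy => hS ?_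
    rw [← two_mul_dist, hy]
    push_cast
    rfl
  · rw [Function.extend_apply' _ _ _ h]; rfl

/-- The uncut fractions satisfy the relation for every `i`. Where a coefficient is set to `0`, the
vector it multiplies vanishes: `low⁴ w` lies in level `-2` for `i = 1`, and `up² w` in level `2D + 2
> n` for `i = D`. -/
theorem uniform_relation_low_up {i D : ℕ} (hn : n = 2 * D + 1) (h1 : 1 ≤ i) (hi : i ≤ D)
    {w : Finset (Fin n) → ℂ} (hw : w ∈ level (Fin n) (2 * i)) :
    eMinus D i • up (up (low (low (low (low w))))) + low (low (up (up (low (low w))))) +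
      ePlus D i • low (low (low (low (up (up w))))) = (4 * fCoeff D i) • low (low w) := by
  have hd := denominator_ne_zero D i
  have key := uniform_relation (by rw [Fintype.card_fin, hn]) (div_mul_cancel₀ _ hd)
    (div_mul_cancel₀ _ hd) hd hw
  rw [← key]
  congr 1
  · congr 1
    unfold eMinus
    split_ifs with h
    · rfl
    · rw [eq_zero_of_mem_level_of_neg
        (low_mem_level (low_mem_level (low_mem_level (low_mem_level hw)))) (by omega)]
      simp
  · unfold ePlus
    split_ifs with h
    · rfl
    · rw [eq_zero_of_mem_level_of_card_lt (up_mem_level (up_mem_level hw))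
        (by rw [Fintype.card_fin]; omega)]
      simp

theorem uniformRelationOn_graph {i D : ℕ} (hn : n = 2 * D + 1) (h1 : 1 ≤ i) (hi : i ≤ D)
    (x : Vertex n) :
    UniformGraph.UniformRelationOn (graph n) x i (eMinus D i) (ePlus D i) (fCoeff D i) := by
  intro v hv
  obtain ⟨w, hw, rfl⟩ := exists_level_comp_diffSet hv
  have key := uniform_relation_low_up hn h1 hi hw
  simp only [pow_two, Matrix.add_mulVec, Matrix.smul_mulVec, ← Matrix.mulVec_mulVec,
    lowering_mulVec, raising_mulVec, map_smul]
  ext y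
  have key' := congrFun key (diffSet x y)
  simp only [Pi.add_apply, Pi.smul_apply, smul_eq_mul, Function.comp_apply] at key' ⊢
  -- Three factors `1/2` on the left give `1/8`; on the right `4f/8 = f/2`, matching the single
  -- `1/2` in `L`.
  linear_combination key' / 8

theorem isStronglyUniformStructure_flatFree {D : ℕ} (hn : n = 2 * D + 1) (x : Vertex n) :
    UniformGraph.IsStronglyUniformStructure (UniformGraph.flatFree (graph n) x) x
      (paramMatrix D) (fun i => fCoeff D i.1) where
  connected := UniformGraph.connected_flatFree (connected_graph n) x
  bipartite := UniformGraph.isBipartite_flatFree (connected_graph n) x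
  ecc_eq := by rw [UniformGraph.ecc_flatFree (connected_graph n), ecc_graph]; omega
  isParameterMatrix := isParameterMatrix_paramMatrix D
  relation i := by
    have hi := Finset.mem_Icc.1 i.2
    rw [eMinus_paramMatrix, ePlus_paramMatrix,
      UniformGraph.uniformRelationOn_flatFree (connected_graph n)]
    exact uniformRelationOn_graph hn hi.1 hi.2 x
  eMinus_ne_zero i h2 hi := by rw [eMinus_paramMatrix]; exact eMinus_ne_zero h2 hi
  ePlus_ne_zero i h1 hi := by rw [ePlus_paramMatrix]; exact ePlus_ne_zero h1 hi

end HalvedCube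

end

theorem theorem9p6 (n D : ℕ) (hn : Odd n) (hn7 : 7 ≤ n) (hD : D = (n - 1) / 2)
    (x : HalvedCube.Vertex n) :
    -- the diameter is `D`
    (HalvedCube.graph n).diam = D ∧
    -- the uniform relation on each `E*_i V`
    (∀ i : ℕ, 1 ≤ i → i ≤ D →
      UniformGraph.UniformRelationOn (HalvedCube.graph n) x i
        (HalvedCube.eMinus D i) (HalvedCube.ePlus D i) (HalvedCube.fCoeff D i)) ∧
    -- the denominators and the off-diagonal coefficients do not vanish
    (∀ i : ℕ, 1 ≤ i → i ≤ D → (6 - 8 * (i : ℂ) + 4 * (D : ℂ)) ≠ 0) ∧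
    (∀ i : ℕ, 2 ≤ i → i ≤ D → HalvedCube.eMinus D i ≠ 0) ∧
    (∀ i : ℕ, 1 ≤ i → i + 1 ≤ D → HalvedCube.ePlus D i ≠ 0) ∧
    -- the principal minors
    (∀ s t : ℕ, 1 ≤ s → s ≤ t → t ≤ D →
      (∏ k ∈ Finset.range (t - s + 1),
        (2 * (D : ℂ) - 4 * (t : ℂ) + 3 + 4 * (k : ℂ))) ≠ 0 ∧
      (UniformGraph.principalSubmatrix (HalvedCube.paramMatrix D) s t).det =
        (((t : ℂ) - (s : ℂ) + 2) * (2 * (D : ℂ) - 2 * (t : ℂ) - 2 * (s : ℂ) + 3) *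
          ∏ k ∈ Finset.range (t - s), (2 * (D : ℂ) - 4 * (t : ℂ) + 5 + 4 * (k : ℂ))) /
        (2 ^ (t - s + 1) *
          ∏ k ∈ Finset.range (t - s + 1), (2 * (D : ℂ) - 4 * (t : ℂ) + 3 + 4 * (k : ℂ))) ∧
      (UniformGraph.principalSubmatrix (HalvedCube.paramMatrix D) s t).det ≠ 0) ∧
    -- these data form a strongly uniform structure
    UniformGraph.IsStronglyUniformStructure (UniformGraph.flatFree (HalvedCube.graph n) x) x
      (HalvedCube.paramMatrix D) (fun i => HalvedCube.fCoeff D i.1) ∧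
    UniformGraph.SupportsStronglyUniformStructure (HalvedCube.graph n) x := by
  have hn' : n = 2 * D + 1 := by
    obtain ⟨k, rfl⟩ := hn
    omega
  refine ⟨?_, fun i h1 hi => HalvedCube.uniformRelationOn_graph hn' h1 hi x,
    fun i _ _ => HalvedCube.denominator_ne_zero D i, fun i => HalvedCube.eMinus_ne_zero,
    fun i => HalvedCube.ePlus_ne_zero, fun s t hs hst ht => ⟨?_,
      HalvedCube.det_principalSubmatrix_paramMatrix hs hst ht,
      HalvedCube.det_principalSubmatrix_paramMatrix_ne_zero hs hst ht⟩,
    HalvedCube.isStronglyUniformStructure_flatFree hn' x,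
    HalvedCube.connected_graph n, HalvedCube.not_isBipartite_graph (by omega), D, _, _,
    HalvedCube.isStronglyUniformStructure_flatFree hn' x⟩
  · rw [HalvedCube.diam_graph]
    omega
  · have h := HalvedCube.odd_prod_ne_zero D t (t - s + 1) 3 (by decide)
    push_cast at h
    exact h
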